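/- Let $L=(X,\le)$ be a finite (non-empty) distributive lattice with minimum $\mathbf 0$. Write $x\prec y$ if $y$ is an upper cover of $x$; an element is meet-irreducible if it has exactly one upper cover. Let $M$ be the set of meet-irreducibles and, for $x\in X$, let $M_x=\{m\in M: x\le m\}$. For $x\prec y$ let $\mathfrak m(x,y)$ be the unique element of $M_x\setminus M_y$. For $m\in M$ let $\mathfrak U_m$ be the set of minimal elements of $\{x\in X:\exists y\in X,\ x\prec y \text{ and } \mathfrak m(x,y)=m\}$, and let $\mathfrak L_m$ be the set of maximal elements of $X\setminus\bigcup_{a\in\mathfrak U_m}\{x\in X: a\le x\}$. Let $\mathcal E(m)$ be the following system of linear inequalities in a variable $w$ and variables $e_x$, where $x$ ranges over $\bigcup_{a\in\mathfrak U_m\cup\mathfrak L_m}(M\setminus M_a)$: if $\mathfrak U_m=\{\mathbf 0\}$, it is the single inequality $w\ge 1$; otherwise it consists of $$\sum_{x\in M\setminus M_a} e_x<w\quad(a\in\mathfrak L_m),\qquad w\le\sum_{x\in M\setminus M_a} e_x\quad(a\in\mathfrak U_m).$$ Then: 1. For every $m\in M$, $|\mathfrak U_m|=1$. 2. For every $m\in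 M$, $\mathcal E(m)$ has a solution in non-negative integers. Explicitly, if $\mathfrak U_m=\{u\}$, then a solution is given by $e_x=1$ for $x\in M\setminus M_u$, $e_x=0$ for all other $x$, and $w=|M\setminus M_u|$ if $u\ne\mathbf 0$, $w=1$ if $u=\mathbf 0$. 3. $L$ is generated by a chip firing game (CFG). That is, there are a finite directed multi-graph $G$ (with vertex set $V$ and $E(v,v')$ edges from $v$ to $v'$) and an initial configuration $\mathcal O:V\to\mathbb N$ such that the game with the following rule cannot be played forever from $\mathcal O$ and reaches a unique fixed point (a configuration in which no vertex is firable), and such that the set of configurations reachable from $\mathcal O$, ordered by $c_1\le c_2$ if $c_1$ can be transformed into $c_2$ by a possibly empty sequence of firings, is isomorphic to $L$ as an ordered set. The rule: a vertex $v$ is firable in a configuration $c:V\to\mathbb N$ if at least one edge goes from $v$ to another vertex and $c(v)\ge\deg^+(v)=\sum_{v'}E(v,v')$; firing $v$ moves one chip of $v$ along each edge leaving $v$. -/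

import Mathlib

namespace ChipFiring

section LatticeNotions

variable {X : Type*} [Lattice X]

/-- An element of a finite lattice is meet-irreducible if it has exactly one upper cover. -/
def IsMeetIrreducible (m : X) : Prop := ∃! y : X, m ⋖ y

variable [Fintype X]

variable (X) in
open Classical in
/-- The collection `M` of the meet-irreducibles of the lattice. -/
noncomputable def meetIrreducibles : Finset X :=
  Finset.univ.filter fun m => IsMeetIrreducible m

open Classical in
/-- `M_x`: the meet-irreducibles that are greater than or equal to `x`. -/
noncomputable def meetIrreduciblesAbove (x : X) : Finset X :=
  (meetIrreducibles X).filter fun m => x ≤ m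

open Classical in
/-- `M \ M_x`: the meet-irreducibles that are not greater than or equal to `x`. -/
noncomputable def meetIrreduciblesNotAbove (x : X) : Finset X :=
  meetIrreducibles X \ meetIrreduciblesAbove x

open Classical in
/-- The cover `x ⋖ y` carries the label `m`, that is, `𝔪(x, y) = m`: the meet-irreducible `m` is
the only element of `M_x \ M_y`. -/
def HasLabel (x y m : X) : Prop :=
  x ⋖ y ∧ meetIrreduciblesAbove x \ meetIrreduciblesAbove y = {m}

/-- `𝔘_m`: the minimal elements of the set of all `x` that have an upper cover `y` with
`𝔪(x, y) = m`. -/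
def upperSystem (m : X) : Set X :=
  {x | Minimal (fun z => ∃ y : X, HasLabel z y m) x}

/-- `𝔏_m`: the maximal elements of the set of all `x` that lie above no element of `𝔘_m`. -/
def lowerSystem (m : X) : Set X :=
  {x | Maximal (fun z => ∀ a ∈ upperSystem m, ¬ a ≤ z) x}

variable (X) in
/-- Names for the variables of the systems of inequalities: the variable `w`, and a variable `e_x`
for an element `x`. A given system mentions only some of the variables `e_x`. -/
inductive Variable where
  | w : Variable
  | e (x : X) : Variable

/-- The assignment `f` of non-negative integers to variables solves the system `𝓔(m)`. If
`𝔘_m = {0}`, the system consists of the inequality `w ≥ 1`; otherwise it consists of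
`∑_{x ∈ M \ M_a} e_x < w` for `a ∈ 𝔏_m` and `w ≤ ∑_{x ∈ M \ M_a} e_x` for `a ∈ 𝔘_m`. -/
def IsSolution [OrderBot X] (m : X) (f : Variable X → ℕ) : Prop :=
  (upperSystem m = {⊥} → 1 ≤ f .w) ∧
  (upperSystem m ≠ {⊥} →
    (∀ a ∈ lowerSystem m, ∑ x ∈ meetIrreduciblesNotAbove a, f (.e x) < f .w) ∧
    (∀ a ∈ upperSystem m, f .w ≤ ∑ x ∈ meetIrreduciblesNotAbove a, f (.e x)))

open Classical in
/-- The explicit assignment attached to an element `u`: `e_x ↦ 1` for `x ∈ M \ M_u`, `e_x ↦ 0` for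
all other `x`, and `w ↦ |M \ M_u|` (but `w ↦ 1` if `u` is the minimum). -/
noncomputable def explicitAssignment [OrderBot X] (u : X) : Variable X → ℕ
  | .e x => if x ∈ meetIrreduciblesNotAbove u then 1 else 0
  | .w => if u = ⊥ then 1 else (meetIrreduciblesNotAbove u).card

end LatticeNotions

/-- A directed multi-graph on the vertex set `V`: `E v v'` is the number of edges from `v` to `v'`;
loops are allowed. -/
structure Multigraph (V : Type*) where
  E : V → V → ℕ

namespace Multigraph

variable {V : Type*} [Fintype V] (G : Multigraph V)

/-- The out-degree of a vertex, loops included. -/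
def outDegree (v : V) : ℕ := ∑ v' : V, G.E v v'

/-- A sink has no edge to another vertex. -/
def IsSink (v : V) : Prop := G.outDegree v = G.E v v

/-- `v` is firable in the configuration `c`. -/
def Firable (c : V → ℕ) (v : V) : Prop := ¬ G.IsSink v ∧ G.outDegree v ≤ c v

open Classical in
/-- The configuration obtained from `c` by firing `v`: one chip moves along each edge that leaves
`v`. -/
noncomputable def fire (c : V → ℕ) (v : V) : V → ℕ := fun x =>
  (if x = v then c x - G.outDegree v else c x) + G.E v x

/-- `c'` is obtained from `c` by firing one firable vertex. -/
def Step (c c' : V → ℕ) : Prop := ∃ v : V, G.Firable c v ∧ c' = G.fire c v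

/-- `c` can be transformed into `c'` by a possibly empty sequence of firings. -/
def Reach (c c' : V → ℕ) : Prop := Relation.ReflTransGen G.Step c c'

/-- The game starting at `c₀` cannot be played forever, and exactly one of the configurations that
it reaches is a fixed point (no vertex is firable). -/
def ReachesUniqueFixedPoint (c₀ : V → ℕ) : Prop :=
  (¬ ∃ s : ℕ → V → ℕ, s 0 = c₀ ∧ ∀ n, G.Step (s n) (s (n + 1))) ∧
  ∃! c : V → ℕ, G.Reach c₀ c ∧ ∀ v, ¬ G.Firable c v

/-- The configuration space `CFG(G, c₀)`. -/
def ConfigSpace (c₀ : V → ℕ) : Type _ := {c : V → ℕ // G.Reach c₀ c}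

/-- `c₁ ≤ c₂` if `c₁` can be transformed into `c₂` by a sequence of firings. -/
instance (c₀ : V → ℕ) : LE (G.ConfigSpace c₀) := ⟨fun c₁ c₂ => G.Reach c₁.1 c₂.1⟩

end Multigraph

/-- The ordered set `X` belongs to `L(CFG)`: there are a finite directed multi-graph `G` and an
initial configuration `c₀` such that the game reaches a unique fixed point and its configuration
space is isomorphic to `X`. -/
def GeneratedByCFG (X : Type*) [LE X] : Prop :=
  ∃ (V : Type) (_ : Fintype V) (G : Multigraph V) (c₀ : V → ℕ),
    G.ReachesUniqueFixedPoint c₀ ∧ Nonempty (G.ConfigSpace c₀ ≃o X)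

end ChipFiring

/-!
Everything rests on the fact that, in a finite distributive lattice, a meet-irreducible `m` is
meet-prime. Hence the elements not below `m` are closed under meets and have a least element `j`,
and `x ≤ m` while `¬ y ≤ m` for a cover `x ⋖ y` is all that it takes for the cover to carry the
label `m` (`hasLabel_iff`). The cover `m ⊓ j ⋖ j` carries this label, and every other cover `x ⋖ y`
labelled `m` has `m ⊓ j ≤ m ⊓ y = x`. So the tails of the labelled covers have the least element
`u = m ⊓ j`, and `𝔘_m = {u}` (`exists_upperSystem_eq_singleton`).

For the explicit solution of `𝓔(m)`, the sum over `M \ M_a` counts `(M \ M_a) ∩ (M \ M_u)`. This is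
all of `M \ M_u` for `a = u`, and it misses an element if `¬ u ≤ a`, because the meet-irreducibles
separate points (`exists_isMeetIrreducible_of_not_le`).

For the game, Birkhoff's theorem turns the lattice into the lower sets of a finite poset `P`. Each
element of `P` is a vertex that sends one chip to every larger element and enough chips to one
additional sink for its out-degree to be `N = |P|`; initially `p` holds `N` chips less one for each
smaller element. Then `p` can fire exactly when all smaller elements have fired, and it is left
without chips for good. The configuration `posetConfig S` after the firings of a lower set `S`
determines `S`, so that reachability is inclusion of lower sets.
-/

namespace ChipFiring

/-! ### Labels of covers -/

section Labels

lemma inf_eq_of_covBy_of_le_of_not_le {X : Type*} [Lattice X] {x y n : X}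
    (h : x ⋖ y) (hx : x ≤ n) (hy : ¬ y ≤ n) :
    n ⊓ y = x :=
  (h.eq_or_eq (le_inf hx h.le) inf_le_right).resolve_right fun he ↦ hy (inf_eq_right.1 he)

variable {X : Type*} [DistribLattice X] [Fintype X]

lemma IsMeetIrreducible.infPrime {m : X} (hm : IsMeetIrreducible m) : InfPrime m := by
  obtain ⟨y, hy, huniq⟩ := hm
  rw [infPrime_iff_infIrred]
  refine ⟨fun h ↦ hy.lt.not_ge (h hy.le), fun b c hbc ↦ ?_⟩
  by_contra! hne
  obtain ⟨y₁, h₁, hb⟩ := exists_covBy_le_of_lt ((hbc ▸ inf_le_left : m ≤ b).lt_of_ne hne.1.symm)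
  obtain ⟨y₂, h₂, hc⟩ := exists_covBy_le_of_lt ((hbc ▸ inf_le_right : m ≤ c).lt_of_ne hne.2.symm)
  rw [huniq y₁ h₁] at hb
  rw [huniq y₂ h₂] at hc
  exact hy.lt.not_ge (hbc ▸ le_inf hb hc)

lemma exists_isMeetIrreducible_of_not_le {u a : X} (h : ¬ u ≤ a) :
    ∃ n : X, IsMeetIrreducible n ∧ a ≤ n ∧ ¬ u ≤ n := by
  obtain ⟨n, han, hn⟩ := (Set.toFinite {z : X | ¬ u ≤ z}).exists_le_maximal h
  -- By maximality everything above `n` is above `u`, so `n ⊔ u` is the only upper cover of `n`.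
  have hlt : ∀ {z}, n < z → n ⊔ u ≤ z := fun {z} hz ↦
    sup_le hz.le (not_not.1 fun hu ↦ hn.not_prop_of_gt hz hu)
  have hn' : n < n ⊔ u := lt_of_le_of_ne le_sup_left fun h ↦ hn.prop (h ▸ le_sup_right)
  exact ⟨n, ⟨n ⊔ u, ⟨hn', fun z hz hz' ↦ hz'.not_ge (hlt hz)⟩,
    fun y hy ↦ ((hlt hy.lt).eq_of_not_lt fun h ↦ hy.2 hn' h).symm⟩, han, hn.prop⟩

lemma mem_meetIrreduciblesAbove {x n : X} :
    n ∈ meetIrreduciblesAbove x ↔ IsMeetIrreducible n ∧ x ≤ n := by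
  simp [meetIrreduciblesAbove, meetIrreducibles]

lemma mem_meetIrreduciblesNotAbove {x n : X} :
    n ∈ meetIrreduciblesNotAbove x ↔ IsMeetIrreducible n ∧ ¬ x ≤ n := by
  simp only [meetIrreduciblesNotAbove, Finset.mem_sdiff, mem_meetIrreduciblesAbove]
  simp +contextual [meetIrreducibles]

lemma mem_upperSystem {m x : X} :
    x ∈ upperSystem m ↔ Minimal (fun z ↦ ∃ y : X, HasLabel z y m) x := Iff.rfl

lemma mem_lowerSystem {m x : X} :
    x ∈ lowerSystem m ↔ Maximal (fun z ↦ ∀ a ∈ upperSystem m, ¬ a ≤ z) x := Iff.rfl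

lemma hasLabel_iff {x y m : X} (hm : IsMeetIrreducible m) :
    HasLabel x y m ↔ x ⋖ y ∧ x ≤ m ∧ ¬ y ≤ m := by
  refine and_congr_right fun hxy ↦ ?_
  simp only [Finset.ext_iff, Finset.mem_sdiff, mem_meetIrreduciblesAbove, Finset.mem_singleton]
  refine ⟨fun h ↦ ?_, fun ⟨hx, hy⟩ n ↦ ⟨fun ⟨⟨hn, hxn⟩, hyn⟩ ↦ ?_, ?_⟩⟩
  · have := (h m).2 rfl
    tauto
  · -- Two primes `n`, `m` with `n ⊓ y = x = m ⊓ y` and `y` below neither lie below each other.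
    have hn' := inf_eq_of_covBy_of_le_of_not_le hxy hxn (fun h ↦ hyn ⟨hn, h⟩)
    have hm' := inf_eq_of_covBy_of_le_of_not_le hxy hx hy
    apply le_antisymm
    · exact (hm.infPrime.2 (hn'.trans_le hx)).resolve_right hy
    · exact (hn.infPrime.2 (hm'.trans_le hxn)).resolve_right fun h ↦ hyn ⟨hn, h⟩
  · rintro rfl
    tauto

lemma exists_isLeast_not_le_of_infPrime {m : X} (hm : InfPrime m) :
    ∃ j, IsLeast {x : X | ¬ x ≤ m} j := by
  have hne : {x : X | ¬ x ≤ m}.Nonempty := by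
    by_contra! h
    exact hm.1 fun x _ ↦ not_not.1 fun hx ↦ (h ▸ hx : x ∈ (∅ : Set X))
  obtain ⟨j, hj⟩ := (Set.toFinite {x : X | ¬ x ≤ m}).exists_minimal hne
  refine ⟨j, hj.prop, fun x hx ↦ ?_⟩
  have hxj : ¬ x ⊓ j ≤ m := fun h ↦ (hm.2 h).elim hx hj.prop
  exact (hj.le_of_le hxj inf_le_right).trans inf_le_left

lemma exists_upperSystem_eq_singleton {m : X} (hm : IsMeetIrreducible m) :
    ∃ u, upperSystem m = {u} := by
  obtain ⟨j, hj, hmin⟩ := exists_isLeast_not_le_of_infPrime hm.infPrime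
  have hleast : IsLeast {z | ∃ y : X, HasLabel z y m} (m ⊓ j) := by
    refine ⟨⟨j, (hasLabel_iff hm).2 ⟨⟨?_, ?_⟩, inf_le_left, hj⟩⟩, ?_⟩
    · exact lt_of_le_of_ne inf_le_right fun h ↦ hj (inf_eq_right.1 h)
    · exact fun z hz hzj ↦ hz.not_ge
        (le_inf (not_not.1 fun h ↦ hzj.not_ge (hmin h)) hzj.le)
    · rintro x ⟨y, hxy⟩
      obtain ⟨hc, hx, hy⟩ := (hasLabel_iff hm).1 hxy
      exact (inf_le_inf_left m (hmin hy)).trans (inf_eq_of_covBy_of_le_of_not_le hc hx hy).le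
  refine ⟨m ⊓ j, Set.ext fun x ↦ ⟨fun hx ↦ ?_, ?_⟩⟩
  · rw [mem_upperSystem] at hx
    exact hx.eq_of_ge hleast.1 (hleast.2 hx.prop)
  · rintro rfl
    exact ⟨hleast.1, fun z hz _ ↦ hleast.2 hz⟩

open Classical in
lemma sum_explicitAssignment [OrderBot X] (u a : X) :
    ∑ x ∈ meetIrreduciblesNotAbove a, explicitAssignment u (.e x) =
      (meetIrreduciblesNotAbove a ∩ meetIrreduciblesNotAbove u).card := by
  simp only [explicitAssignment, Finset.sum_boole, Finset.filter_mem_eq_inter, Nat.cast_id]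

lemma isSolution_explicitAssignment [OrderBot X] {m u : X} (hu : upperSystem m = {u}) :
    IsSolution m (explicitAssignment u) := by
  classical
  refine ⟨fun h ↦ ?_, fun h ↦ ?_⟩
  · rw [hu, Set.singleton_eq_singleton_iff] at h
    simp [explicitAssignment, h]
  · have hne : u ≠ ⊥ := fun he ↦ h (he ▸ hu)
    simp only [sum_explicitAssignment]
    simp only [explicitAssignment, if_neg hne, hu, Set.mem_singleton_iff]
    refine ⟨fun a ha ↦ Finset.card_lt_card ?_, ?_⟩
    · have hua : ¬ u ≤ a := (mem_lowerSystem.1 ha).prop u (hu ▸ rfl)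
      obtain ⟨n, hn, han, hun⟩ := exists_isMeetIrreducible_of_not_le hua
      refine Finset.ssubset_iff_subset_ne.2 ⟨Finset.inter_subset_right, fun he ↦ ?_⟩
      have hmem := mem_meetIrreduciblesNotAbove.2 ⟨hn, hun⟩
      rw [← he, Finset.mem_inter, mem_meetIrreduciblesNotAbove] at hmem
      exact hmem.1.2 han
    · rintro a rfl
      rw [Finset.inter_self]

end Labels

/-! ### Games whose steps mirror the covers of an ordered set -/

section Transfer

variable {V : Type} [Fintype V] {G : Multigraph V} {L : Type*} [PartialOrder L] [Finite L]

/-- If firings starting from configurations `φ S` lead upwards to configurations of the same form,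
and every cover of `L` is realized by a firing, then reachability between the `φ S` is the
order of `L`. -/
lemma reach_iff_of_step {φ : L → V → ℕ} (hcov : ∀ S T, S ⋖ T → G.Step (φ S) (φ T))
    (hstep : ∀ S c, G.Step (φ S) c → ∃ T, S < T ∧ c = φ T) (S : L) (c : V → ℕ) :
    G.Reach (φ S) c ↔ ∃ T, S ≤ T ∧ c = φ T := by
  constructor
  · intro h
    induction h with
    | refl => exact ⟨S, le_rfl, rfl⟩
    | tail _ hs ih =>
      obtain ⟨T, hT, rfl⟩ := ih
      obtain ⟨T', hT', rfl⟩ := hstep T _ hs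
      exact ⟨T', hT.trans hT'.le, rfl⟩
  · rintro ⟨T, hT, rfl⟩
    classical
    have := Fintype.ofFinite L
    have : LocallyFiniteOrder L := Fintype.toLocallyFiniteOrder
    exact (le_iff_reflTransGen_covBy.1 hT).lift φ hcov

/-- A game whose firings from the injectively parametrized configurations `φ S` all lead upwards in
a finite bounded order `L`, and realize its covers, generates `L`: it stops because `L` has no
infinite ascending chain, and its fixed point is `φ ⊤`, the only one without a cover to realize. -/
lemma generatedByCFG_of_step [BoundedOrder L] {X : Type*} [LE X] (e : L ≃o X)
    {φ : L → V → ℕ} (hφ : Function.Injective φ) (hcov : ∀ S T, S ⋖ T → G.Step (φ S) (φ T))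
    (hstep : ∀ S c, G.Step (φ S) c → ∃ T, S < T ∧ c = φ T) : GeneratedByCFG X := by
  have hreach := reach_iff_of_step hcov hstep
  refine ⟨V, ‹_›, G, φ ⊥, ⟨?_, φ ⊤, ⟨(hreach _ _).2 ⟨⊤, bot_le, rfl⟩, fun v hv ↦ ?_⟩, ?_⟩, ?_⟩
  · rintro ⟨s, hs₀, hs⟩
    have hex : ∀ n, ∃ T, s n = φ T := by
      intro n
      induction n with
      | zero => exact ⟨⊥, hs₀⟩
      | succ n ih =>
        obtain ⟨T, hT⟩ := ih
        obtain ⟨T', -, h⟩ := hstep T _ (hT ▸ hs n)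
        exact ⟨T', h⟩
    choose t ht using hex
    have hmono : StrictMono t := strictMono_nat_of_lt_succ fun n ↦ by
      obtain ⟨T, hlt, hT⟩ := hstep (t n) _ (ht n ▸ hs n)
      rwa [hφ ((ht (n + 1)).symm.trans hT)]
    exact not_injective_infinite_finite t hmono.injective
  · obtain ⟨T, hT, -⟩ := hstep ⊤ _ ⟨v, hv, rfl⟩
    exact not_top_lt hT
  · rintro c ⟨hc, hfix⟩
    obtain ⟨T, -, rfl⟩ := (hreach _ _).1 hc
    by_contra hne
    obtain ⟨T', hT', -⟩ := exists_covBy_le_of_lt (lt_top_iff_ne_top.2 fun h : T = ⊤ ↦ hne (h ▸ rfl))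
    obtain ⟨v, hv, -⟩ := hcov _ _ hT'
    exact hfix v hv
  · let ψ : L → G.ConfigSpace (φ ⊥) := fun S ↦ ⟨φ S, (hreach _ _).2 ⟨S, bot_le, rfl⟩⟩
    have hψ : Function.Bijective ψ := by
      refine ⟨fun S T h ↦ hφ (congrArg Subtype.val h), fun ⟨c, hc⟩ ↦ ?_⟩
      obtain ⟨T, -, rfl⟩ := (hreach _ _).1 hc
      exact ⟨T, rfl⟩
    have hle : ∀ {S T}, ψ S ≤ ψ T ↔ S ≤ T := fun {S T} ↦
      (hreach S (φ T)).trans ⟨fun ⟨T', h, h'⟩ ↦ hφ h' ▸ h, fun h ↦ ⟨T, h, rfl⟩⟩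
    exact ⟨(⟨Equiv.ofBijective ψ hψ, hle⟩ : L ≃o G.ConfigSpace (φ ⊥)).symm.trans e⟩

end Transfer

/-! ### The game of a finite poset -/

section Poset

lemma card_filter_lt_card {P : Type*} [Fintype P] (p : P) {f : P → Prop} [DecidablePred f]
    (hp : ¬ f p) : (Finset.univ.filter f).card < Fintype.card P :=
  Finset.card_lt_univ_of_notMem (x := p) (by simpa using hp)

variable {P : Type} [PartialOrder P]

/-- The lower set `S ∪ {p}`, where `S` contains all elements below `p`. -/
def insertMinimal (S : LowerSet P) (p : P) (hp : ∀ q < p, q ∈ S) : LowerSet P where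
  carrier := insert p S
  lower' := by
    rintro a b hba (rfl | ha)
    · exact hba.eq_or_lt.imp id (hp b)
    · exact Or.inr (S.lower hba ha)

lemma mem_insertMinimal {S : LowerSet P} {p : P} {hp : ∀ q < p, q ∈ S} {q : P} :
    q ∈ insertMinimal S p hp ↔ q = p ∨ q ∈ S := Iff.rfl

lemma lt_insertMinimal {S : LowerSet P} {p : P} (hp : ∀ q < p, q ∈ S) (h : p ∉ S) :
    S < insertMinimal S p hp :=
  lt_of_le_of_ne (fun _ hq ↦ Or.inr hq) fun he ↦ h (he ▸ Or.inl rfl)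

variable [Fintype P]

variable (P) in
open Classical in
/-- The graph on `P` and a sink `none`: one edge from `p` to each larger element, and as many edges
from `p` to the sink as bring its out-degree to `|P|`. -/
noncomputable def posetGraph : Multigraph (Option P) where
  E
    | some p, some q => if p < q then 1 else 0
    | some p, none => Fintype.card P - (Finset.univ.filter fun q ↦ p < q).card
    | none, _ => 0

open Classical in
/-- The configuration after each element of the lower set `S` has fired once. An element outside
`S` lacks one chip for each smaller element that has not fired. -/
noncomputable def posetConfig (S : LowerSet P) : Option P → ℕ
  | some p => if p ∈ S then 0 else
      Fintype.card P - (Finset.univ.filter fun q ↦ q < p ∧ q ∉ S).card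
  | none => ∑ p ∈ Finset.univ.filter (· ∈ S), (posetGraph P).E (some p) none

lemma posetGraph_outDegree (p : P) : (posetGraph P).outDegree (some p) = Fintype.card P := by
  classical
  have := card_filter_lt_card p (f := fun q ↦ p < q) (lt_irrefl p)
  simp only [Multigraph.outDegree, Fintype.sum_option, posetGraph, Finset.sum_boole, Nat.cast_id]
  exact Nat.sub_add_cancel this.le

lemma mem_iff_posetConfig_eq_zero (S : LowerSet P) (p : P) :
    p ∈ S ↔ posetConfig S (some p) = 0 := by
  classical
  have := card_filter_lt_card p (f := fun q ↦ q < p ∧ q ∉ S) (fun h ↦ lt_irrefl p h.1)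
  by_cases h : p ∈ S
  · simp [posetConfig, h]
  · simp only [posetConfig, h, if_false, false_iff]
    omega

lemma posetConfig_injective : Function.Injective (posetConfig (P := P)) := fun S T h ↦
  SetLike.ext fun p ↦ by rw [mem_iff_posetConfig_eq_zero, h, ← mem_iff_posetConfig_eq_zero]

lemma firable_posetConfig_iff (S : LowerSet P) (p : P) :
    (posetGraph P).Firable (posetConfig S) (some p) ↔ p ∉ S ∧ ∀ q < p, q ∈ S := by
  classical
  have hpos : 0 < Fintype.card P := Fintype.card_pos_iff.2 ⟨p⟩
  have hsink : ¬ (posetGraph P).IsSink (some p) := by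
    rw [Multigraph.IsSink, posetGraph_outDegree]
    simpa [posetGraph] using hpos.ne'
  simp only [Multigraph.Firable, hsink, not_false_eq_true, true_and, posetGraph_outDegree]
  by_cases h : p ∈ S
  · simp [posetConfig, h, hpos.ne']
  · have hc : Fintype.card P ≤ posetConfig S (some p) ↔
        (Finset.univ.filter fun q ↦ q < p ∧ q ∉ S).card = 0 := by
      simp only [posetConfig, h, if_false]
      omega
    simp [hc, h, Finset.filter_eq_empty_iff]

lemma fire_posetConfig (S : LowerSet P) (p : P) (h : p ∉ S) (hp : ∀ q < p, q ∈ S) :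
    (posetGraph P).fire (posetConfig S) (some p) = posetConfig (insertMinimal S p hp) := by
  classical
  funext v
  rcases v with _ | q
  · have hins : Finset.univ.filter (· ∈ insertMinimal S p hp) =
        insert p (Finset.univ.filter (· ∈ S)) := by
      ext q
      simp [mem_insertMinimal]
    simp only [Multigraph.fire, posetConfig, reduceCtorEq, if_false, hins]
    rw [Finset.sum_insert (by simpa using h), add_comm]
  · rcases eq_or_ne q p with rfl | hqp
    · simp only [Multigraph.fire, if_true, posetGraph_outDegree]
      simp [posetConfig, posetGraph, mem_insertMinimal, h]
    · simp only [Multigraph.fire, Option.some.injEq, hqp, if_false]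
      by_cases hq : q ∈ S
      · have : ¬ p < q := fun hlt ↦ h (S.lower hlt.le hq)
        simp [posetConfig, posetGraph, mem_insertMinimal, hq, this]
      · simp only [posetConfig, posetGraph, mem_insertMinimal, hq, hqp, or_self, if_false]
        have hlt := card_filter_lt_card q (f := fun r ↦ r < q ∧ r ∉ S) (fun h ↦ lt_irrefl q h.1)
        by_cases hpq : p < q
        · -- The chip from `p` settles the one that `q` lacked because of `p`.
          have hins : (Finset.univ.filter fun r ↦ r < q ∧ r ∉ S) =
              insert p (Finset.univ.filter fun r ↦ r < q ∧ ¬ (r = p ∨ r ∈ S)) := by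
            ext r
            by_cases hr : r = p <;> simp [hr, hpq, h]
          rw [hins, Finset.card_insert_of_notMem (by simp)] at hlt ⊢
          simp only [hpq, if_true]
          omega
        · have heq : (Finset.univ.filter fun r ↦ r < q ∧ r ∉ S) =
              Finset.univ.filter fun r ↦ r < q ∧ ¬ (r = p ∨ r ∈ S) := by
            ext r
            by_cases hr : r = p <;> simp [hr, hpq]
          simp [heq, hpq]

lemma step_posetConfig_of_covBy {S T : LowerSet P} (h : S ⋖ T) :
    (posetGraph P).Step (posetConfig S) (posetConfig T) := by
  obtain ⟨x, hxT, hxS⟩ := Set.exists_of_ssubset (LowerSet.coe_ssubset_coe.2 h.lt)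
  obtain ⟨p, -, hp⟩ := (Set.toFinite {q | q ∈ T ∧ q ∉ S}).exists_le_minimal
    (⟨hxT, hxS⟩ : x ∈ {q | q ∈ T ∧ q ∉ S})
  have hlow : ∀ q < p, q ∈ S := fun q hq ↦
    not_not.1 fun hqS ↦ hp.not_prop_of_lt hq ⟨T.lower hq.le hp.prop.1, hqS⟩
  have hle : insertMinimal S p hlow ≤ T := by
    rintro q (rfl | hq)
    exacts [hp.prop.1, h.le hq]
  have hT : T = insertMinimal S p hlow :=
    (hle.eq_of_not_lt fun hlt ↦ h.2 (lt_insertMinimal hlow hp.prop.2) hlt).symm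
  refine ⟨some p, (firable_posetConfig_iff S p).2 ⟨hp.prop.2, hlow⟩, ?_⟩
  rw [fire_posetConfig S p hp.prop.2 hlow, hT]

lemma exists_lt_of_step_posetConfig {S : LowerSet P} {c : Option P → ℕ}
    (h : (posetGraph P).Step (posetConfig S) c) : ∃ T, S < T ∧ c = posetConfig T := by
  obtain ⟨_ | p, hv, rfl⟩ := h
  · exact absurd (by simp [Multigraph.IsSink, Multigraph.outDegree, posetGraph]) hv.1
  · obtain ⟨hpS, hlow⟩ := (firable_posetConfig_iff S p).1 hv
    exact ⟨_, lt_insertMinimal hlow hpS, fire_posetConfig S p hpS hlow⟩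

end Poset

lemma generatedByCFG_of_distribLattice.{u} {X : Type u} [DistribLattice X] [OrderBot X] [Finite X] :
    GeneratedByCFG X := by
  classical
  have := Fintype.ofFinite X
  -- The vertices of a game live in `Type`, so the poset of irreducibles is moved there.
  let P := Shrink.{0, u} {a : X // SupIrred a}
  have : Fintype P := Fintype.ofFinite P
  let e : LowerSet P ≃o X :=
    (LowerSet.map (orderIsoShrink.{0} {a : X // SupIrred a}).symm).trans
      OrderIso.lowerSetSupIrred.symm
  exact generatedByCFG_of_step e posetConfig_injective (fun _ _ ↦ step_posetConfig_of_covBy)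
    fun _ _ ↦ exists_lt_of_step_posetConfig

end ChipFiring

theorem mainTheorem10 {X : Type*} [DistribLattice X] [BoundedOrder X] [Fintype X] :
    (∀ m : X, ChipFiring.IsMeetIrreducible m → (ChipFiring.upperSystem m).ncard = 1) ∧
    (∀ m : X, ChipFiring.IsMeetIrreducible m →
      ∃ f : ChipFiring.Variable X → ℕ, ChipFiring.IsSolution m f) ∧
    (∀ m u : X, ChipFiring.IsMeetIrreducible m → ChipFiring.upperSystem m = {u} →
      ChipFiring.IsSolution m (ChipFiring.explicitAssignment u)) ∧
    ChipFiring.GeneratedByCFG X := by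
  refine ⟨fun m hm ↦ Set.ncard_eq_one.2 (ChipFiring.exists_upperSystem_eq_singleton hm),
    fun m hm ↦ ?_, fun m u _ hu ↦ ChipFiring.isSolution_explicitAssignment hu,
    ChipFiring.generatedByCFG_of_distribLattice⟩
  obtain ⟨u, hu⟩ := ChipFiring.exists_upperSystem_eq_singleton hm
  exact ⟨_, ChipFiring.isSolution_explicitAssignment hu⟩
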